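/- Consider a $K$-user interference channel with single-antenna nodes and fixed complex channel coefficients $h_{ij}$, known to all nodes: \[Y_i(t)=\sum_{j=1}^K h_{ij}X_j(t)+Z_i(t),\qquad i\in[K]=\{1,\dots,K\},\] where the noises $Z_i(t)$ are independent circularly symmetric complex Gaussian variables with mean zero and variance one. Messages $W_1,\dots,W_K$ are independent and uniformly distributed; $W_i$ is intended for receiver $i$ and is available exactly at the transmitters in its transmit set $\mathcal T_i\subseteq[K]$. In a block code of length $n$, the block sent by transmitter $j$ is a function of the messages $W_i$ with $j\in\mathcal T_i$, and receiver $i$ estimates $W_i$ from its received block $(Y_i(1),\dots,Y_i(n))$. The code has power at most $P$ if $\frac1n\sum_{t=1}^n\sum_{j=1}^K\mathbb E|X_j(t)|^2\le P$. A tuple $(R_1,\dots,R_K)$ of nonnegative rates is achievable at power $P$ if for every $\varepsilon>0$ and every sufficiently large $n$ there is a code of length $n$ and power at most $P$ in which $W_i$ takes $|W_i|$ values with $\frac{\log|W_i|}{n}\ge R_i$ and receiver $i$ decodes $W_i$ with error probability at most $\varepsilon$, for all $i\in[K]$. Let $C_\Sigma(P)$ be the supremum of $\sum_i R_i$ over all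 achievable rate tuples, and let the degrees of freedom (DoF) of the channel be \[\eta=\limsup_{P\to\infty}\frac{C_\Sigma(P)}{\log P}.\] For $\mathcal A\subseteq[K]$ put $U_{\mathcal A}=\bigcup_{i\notin\mathcal A}\mathcal T_i$ and $\bar U_{\mathcal A}=[K]\setminus U_{\mathcal A}$. For a vector $V=(V_1,\dots,V_K)$ and $\mathcal S\subseteq[K]$ write $V_{\mathcal S}=(V_i)_{i\in\mathcal S}$. **Lemma.** If there exist a set $\mathcal A\subseteq[K]$ and a function $f$ such that \[f\left(Y_{\mathcal A},Z_{\mathcal A},X_{\bar U_{\mathcal A}}\right)=X_{U_{\mathcal A}}\] for all input vectors $X\in\mathbb C^K$ and all noise vectors $Z\in\mathbb C^K$, where $Y_i=\sum_j h_{ij}X_j+Z_i$, then $\eta\le|\mathcal A|$. -/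

import Mathlib

open MeasureTheory ProbabilityTheory Filter

noncomputable section

namespace InterferenceChannel

/-- The law of a zero-mean, unit-variance, circularly symmetric complex Gaussian variable:
the real and imaginary parts are independent real Gaussians of mean `0` and variance `1/2`. -/
def complexGaussian : Measure ℂ :=
  ((gaussianReal 0 (1 / 2)).prod (gaussianReal 0 (1 / 2))).map Complex.measurableEquivRealProd.symm

instance : IsProbabilityMeasure complexGaussian :=
  Measure.isProbabilityMeasure_map Complex.measurableEquivRealProd.symm.measurable.aemeasurable

/-- The joint law of the noises `Z i t` (receiver `i`, time `t`) over `n` channel uses: they are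
independent, each with law `complexGaussian`. -/
def noise (K n : ℕ) : Measure (Fin K → Fin n → ℂ) :=
  Measure.pi fun _ => Measure.pi fun _ => complexGaussian

/-- One use of the channel with coefficients `H i j` (from transmitter `j` to receiver `i`):
`Y i = ∑ j, H i j * X j + Z i`. -/
def output {K : ℕ} (H : Matrix (Fin K) (Fin K) ℂ) (x z : Fin K → ℂ) : Fin K → ℂ :=
  fun i => ∑ j, H i j * x j + z i

/-- A block code of length `n` for the transmit sets `T`. Message `i` takes `size i` values and is
known exactly to the transmitters in `T i`: the block sent by transmitter `j` is a function of the
messages `i` with `j ∈ T i`. Receiver `i` estimates message `i` from its own received block. -/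
structure Code {K : ℕ} (T : Fin K → Finset (Fin K)) (n : ℕ) where
  size : Fin K → ℕ
  size_pos : ∀ i, 0 < size i
  enc : (j : Fin K) → ((i : {i : Fin K // j ∈ T i}) → Fin (size i)) → Fin n → ℂ
  dec : (i : Fin K) → (Fin n → ℂ) → Fin (size i)
  measurable_dec : ∀ i, Measurable (dec i)

namespace Code

variable {K n : ℕ} {T : Fin K → Finset (Fin K)}

/-- A choice of one value for each of the `K` messages. -/
abbrev Messages (c : Code T n) : Type := (i : Fin K) → Fin (c.size i)

/-- The signal of transmitter `j` at time `t` when the messages are `w`. -/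
def signal (c : Code T n) (w : c.Messages) (j : Fin K) (t : Fin n) : ℂ :=
  c.enc j (fun i => w i) t

/-- The signal at receiver `i` at time `t` for messages `w` and noise block `z`. -/
def received (c : Code T n) (H : Matrix (Fin K) (Fin K) ℂ) (w : c.Messages)
    (z : Fin K → Fin n → ℂ) (i : Fin K) (t : Fin n) : ℂ :=
  output H (fun j => c.signal w j t) (fun k => z k t) i

/-- Expected energy of a block, summed over all transmitters, for independent and uniformly
distributed messages. -/
def energy (c : Code T n) : ℝ :=
  (∑ w : c.Messages, ∑ j, ∑ t, ‖c.signal w j t‖ ^ 2) / Fintype.card c.Messages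

/-- Probability that receiver `i` decodes its message wrongly, for independent and uniformly
distributed messages that are independent of the noise. -/
def errorProb (c : Code T n) (H : Matrix (Fin K) (Fin K) ℂ) (i : Fin K) : ℝ :=
  (∑ w : c.Messages, (noise K n).real {z | c.dec i (c.received H w z i) ≠ w i}) /
    Fintype.card c.Messages

end Code

/-- The rate tuple `R` (in nats per channel use) is achievable under the total average power
constraint `P`: for every `ε > 0` and every large enough block length `n` there is a code of power
at most `P`, with rates at least `R i`, all of whose error probabilities are at most `ε`. -/
def Achievable {K : ℕ} (H : Matrix (Fin K) (Fin K) ℂ) (T : Fin K → Finset (Fin K)) (P : ℝ)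
    (R : Fin K → ℝ) : Prop :=
  ∀ ε : ℝ, 0 < ε → ∀ᶠ n : ℕ in atTop, ∃ c : Code T n,
    c.energy ≤ n * P ∧
    (∀ i, R i ≤ Real.log (c.size i) / n) ∧
    ∀ i, c.errorProb H i ≤ ε

/-- The capacity region: all achievable tuples of nonnegative rates. -/
def capacityRegion {K : ℕ} (H : Matrix (Fin K) (Fin K) ℂ) (T : Fin K → Finset (Fin K)) (P : ℝ) :
    Set (Fin K → ℝ) :=
  {R | (∀ i, 0 ≤ R i) ∧ Achievable H T P R}

/-- The sum capacity, as an extended real number (no finiteness is presupposed). -/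
def sumCapacity {K : ℕ} (H : Matrix (Fin K) (Fin K) ℂ) (T : Fin K → Finset (Fin K)) (P : ℝ) :
    EReal :=
  ⨆ R ∈ capacityRegion H T P, ((∑ i, R i : ℝ) : EReal)

/-- The degrees of freedom: the limit superior of `sumCapacity P / log P` as `P → ∞`. -/
def dof {K : ℕ} (H : Matrix (Fin K) (Fin K) ℂ) (T : Fin K → Finset (Fin K)) : EReal :=
  limsup (fun P : ℝ => sumCapacity H T P / ((Real.log P : ℝ) : EReal)) atTop

/-- The transmitters that know at least one message outside `A`: the union of `T i`, `i ∉ A`. -/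
def outsideTransmitters {K : ℕ} (T : Fin K → Finset (Fin K)) (A : Finset (Fin K)) :
    Finset (Fin K) :=
  Aᶜ.biUnion T

/-- The part of a vector of signals with indices in `S`. -/
def part {K : ℕ} (S : Finset (Fin K)) (x : Fin K → ℂ) : {i : Fin K // i ∈ S} → ℂ :=
  fun i => x i

end InterferenceChannel

end

open InterferenceChannel

namespace InterferenceChannel

open scoped ENNReal
open Matrix

/-! A packing argument with volumes takes the place of entropy. Write `U` for the transmitters that
know some message outside `A`. The function `f` matters only through injectivity: an input supported
on `U` that vanishes at the receivers in `A` is zero. So on such inputs a linear map `Ψ` recovers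
all noiseless outputs from those in `A` (`exists_linearMap_extend_output`).

Given the outputs in `A`, decode the messages of `A`, subtract the signals of the transmitters
outside `U`, which depend on these messages only, and apply `Ψ`. If decoding is correct, this
estimates the other outputs up to a multiple of the noise. Hence typical outputs have energy `O(nP)`
in the coordinates of `A` and lie within energy `O(n)` of the estimate in the others. A Gaussian
weight adapted to this region has integral `exp (O(n)) * P ^ (n * |A|)`.

The sets of correctly decoded outputs of different messages are disjoint, and the noise law is
dominated by Lebesgue measure, so the success probabilities sum to at most that integral
(`sum_noise_goodNoise_le`). Reliability turns this into a bound on the number of messages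
(`card_messages_le`); its logarithm divided by `n` is `|A| log P + O(1)`. -/

/-! ### Gaussian noise: domination by volume and energy tail -/

lemma measure_pi_mono {ι : Type*} [Fintype ι] {α : ι → Type*} [∀ i, MeasurableSpace (α i)]
    {μ ν : ∀ i, Measure (α i)} (h : ∀ i, μ i ≤ ν i) : Measure.pi μ ≤ Measure.pi ν := by
  refine Measure.le_iff.2 fun s hs => ?_
  rw [Measure.pi, Measure.pi, toMeasure_apply _ _ hs, toMeasure_apply _ _ hs]
  -- The product outer measure is the largest one bounded by the product on boxes, so boxes suffice.
  have : OuterMeasure.pi (fun i => (μ i).toOuterMeasure) ≤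
      OuterMeasure.pi (fun i => (ν i).toOuterMeasure) := by
    refine OuterMeasure.le_pi.2 fun t _ => (OuterMeasure.pi_pi_le _ _).trans ?_
    exact Finset.prod_le_prod' fun i _ => h i _
  exact this s

lemma measure_prod_mono {α β : Type*} [MeasurableSpace α] [MeasurableSpace β]
    {μ μ' : Measure α} {ν ν' : Measure β} [SFinite ν] [SFinite ν'] (h : μ ≤ μ') (h' : ν ≤ ν') :
    μ.prod ν ≤ μ'.prod ν' := by
  refine Measure.le_iff.2 fun s hs => ?_
  rw [Measure.prod_apply hs, Measure.prod_apply hs]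
  exact lintegral_mono' h fun x => h' _

/-- At variance `1/2` the density peaks at `1 / √π < 1`. Domination replaces noise probabilities by
volumes, which are invariant under translation by codewords. -/
lemma gaussianReal_half_le_volume : gaussianReal 0 (1 / 2) ≤ (volume : Measure ℝ) := by
  rw [gaussianReal_of_var_ne_zero _ (by norm_num)]
  nth_rw 2 [← withDensity_one (μ := (volume : Measure ℝ))]
  refine withDensity_mono (ae_of_all _ fun x => ?_)
  rw [gaussianPDF_def, Pi.one_apply]
  refine ENNReal.ofReal_le_one.2 ?_
  rw [gaussianPDFReal]
  refine mul_le_one₀ (inv_le_one_of_one_le₀ ?_) (Real.exp_nonneg _) (Real.exp_le_one_iff.2 ?_)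
  · rw [Real.one_le_sqrt]
    push_cast
    linarith [Real.pi_gt_three]
  · exact div_nonpos_of_nonpos_of_nonneg (neg_nonpos.2 (sq_nonneg _)) (by positivity)

lemma complexGaussian_le_volume : complexGaussian ≤ (volume : Measure ℂ) := by
  rw [complexGaussian, ← Complex.volume_preserving_equiv_real_prod.symm.map_eq]
  exact Measure.map_mono
    (measure_prod_mono gaussianReal_half_le_volume gaussianReal_half_le_volume)
    Complex.measurableEquivRealProd.symm.measurable

lemma noise_le_volume (K n : ℕ) : noise K n ≤ volume :=
  measure_pi_mono fun _ => measure_pi_mono fun _ => complexGaussian_le_volume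

instance (K n : ℕ) : IsProbabilityMeasure (noise K n) := by
  unfold noise; infer_instance

lemma lintegral_sq_complexGaussian_ne_top :
    ∫⁻ z, ENNReal.ofReal (‖z‖ ^ 2) ∂complexGaussian ≠ ∞ := by
  have hi : Integrable (fun x : ℝ => x ^ 2) (gaussianReal 0 (1 / 2)) :=
    (memLp_id_gaussianReal 2).integrable_sq
  have h : Integrable (fun z : ℂ => ‖z‖ ^ 2) complexGaussian := by
    rw [complexGaussian, integrable_map_equiv]
    refine ((hi.comp_fst _).add (hi.comp_snd _)).congr (ae_of_all _ fun p => ?_)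
    have hp : Complex.measurableEquivRealProd.symm p = ⟨p.1, p.2⟩ := rfl
    simp [hp, Complex.sq_norm, Complex.normSq_apply, ← sq]
  rw [← ofReal_integral_eq_lintegral_ofReal h (ae_of_all _ fun _ => by positivity)]
  exact ENNReal.ofReal_ne_top

/-- The energy of a family of signal blocks. -/
noncomputable def blockEnergy {ι : Type*} [Fintype ι] {n : ℕ} (y : ι → Fin n → ℂ) : ℝ :=
  ∑ i, ∑ t, ‖y i t‖ ^ 2

@[fun_prop]
lemma measurable_blockEnergy {ι : Type*} [Fintype ι] {n : ℕ} :
    Measurable (blockEnergy : (ι → Fin n → ℂ) → ℝ) := by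
  unfold blockEnergy; fun_prop

lemma blockEnergy_nonneg {ι : Type*} [Fintype ι] {n : ℕ} (y : ι → Fin n → ℂ) :
    0 ≤ blockEnergy y := by
  unfold blockEnergy; positivity

/-- With probability at least `3/4` the energy of the noise is linear in the block length. -/
lemma exists_noise_energy_tail_le (K : ℕ) : ∃ C : ℝ, 0 < C ∧ ∀ n : ℕ, 0 < n →
    (noise K n).real {z | C * n ≤ blockEnergy z} ≤ 1 / 4 := by
  set v := ∫⁻ z, ENNReal.ofReal (‖z‖ ^ 2) ∂complexGaussian with hv
  have hvr : v = ENNReal.ofReal v.toReal :=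
    (ENNReal.ofReal_toReal lintegral_sq_complexGaussian_ne_top).symm
  have hv0 : 0 ≤ v.toReal := ENNReal.toReal_nonneg
  -- Markov's inequality: the mean energy is `K * n * v`. The added ones only keep the constant
  -- positive.
  refine ⟨4 * (v.toReal + 1) * (K + 1), by positivity, fun n hn => ?_⟩
  have hn' : (0 : ℝ) < n := by exact_mod_cast hn
  set R : ℝ := 4 * (v.toReal + 1) * (K + 1) * n with hR
  have hR0 : 0 < R := by positivity
  have hint : ∫⁻ z, ENNReal.ofReal (blockEnergy z) ∂noise K n =
      ENNReal.ofReal (K * n * v.toReal) := by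
    have h1 : ∀ z : Fin K → Fin n → ℂ, ENNReal.ofReal (blockEnergy z) =
        ∑ i, ∑ t, ENNReal.ofReal (‖z i t‖ ^ 2) := fun z => by
      rw [blockEnergy, ENNReal.ofReal_sum_of_nonneg fun _ _ => by positivity]
      exact Finset.sum_congr rfl fun i _ =>
        ENNReal.ofReal_sum_of_nonneg fun _ _ => by positivity
    have h2 : ∀ (i : Fin K) (t : Fin n),
        ∫⁻ z, ENNReal.ofReal (‖z i t‖ ^ 2) ∂noise K n = v := fun i t => by
      have hmp : MeasurePreserving (fun z : Fin K → Fin n → ℂ => z i t) (noise K n)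
          complexGaussian :=
        (measurePreserving_eval (fun _ : Fin n => complexGaussian) t).comp
          (measurePreserving_eval
            (fun _ : Fin K => Measure.pi fun _ : Fin n => complexGaussian) i)
      exact hmp.lintegral_comp (f := fun x : ℂ => ENNReal.ofReal (‖x‖ ^ 2)) (by fun_prop)
    simp_rw [h1]
    rw [lintegral_finsetSum _ fun i _ => by fun_prop]
    have h3 : ∀ i : Fin K, ∫⁻ z, ∑ t, ENNReal.ofReal (‖z i t‖ ^ 2) ∂noise K n =
        ∑ _t : Fin n, v := fun i => by
      rw [lintegral_finsetSum _ fun t _ => by fun_prop]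
      exact Finset.sum_congr rfl fun t _ => h2 i t
    simp_rw [h3]
    rw [hvr, ENNReal.toReal_ofReal hv0]
    simp only [Finset.sum_const, Finset.card_univ, Fintype.card_fin, nsmul_eq_mul]
    rw [ENNReal.ofReal_mul (by positivity), ENNReal.ofReal_mul (by positivity)]
    simp [mul_assoc]
  have hM := mul_meas_ge_le_lintegral (μ := noise K n)
    (f := fun z => ENNReal.ofReal (blockEnergy z)) (by fun_prop) (ENNReal.ofReal R)
  rw [hint] at hM
  simp_rw [ENNReal.ofReal_le_ofReal_iff (blockEnergy_nonneg _)] at hM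
  rw [← ofReal_measureReal, ← ENNReal.ofReal_mul hR0.le,
    ENNReal.ofReal_le_ofReal_iff (by positivity)] at hM
  have : K * n * v.toReal ≤ R * (1 / 4) := by
    rw [hR]; nlinarith [mul_nonneg hn'.le hv0, (Nat.cast_nonneg K : (0 : ℝ) ≤ K),
      mul_nonneg (Nat.cast_nonneg K : (0 : ℝ) ≤ K) hn'.le]
  exact le_of_mul_le_mul_left (hM.trans this) hR0

/-! ### Gaussian weights and packing of translates -/

lemma lintegral_exp_neg_blockEnergy (ι : Type*) [Fintype ι] (n : ℕ) {a : ℝ} (ha : 0 < a) :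
    ∫⁻ y : ι → Fin n → ℂ, ENNReal.ofReal (Real.exp (-(a * blockEnergy y))) =
      ENNReal.ofReal ((Real.pi / a) ^ (n * Fintype.card ι)) := by
  have h1 : ∫ z : ℂ, Real.exp (-a * ‖z‖ ^ 2) = Real.pi / a := by
    rw [GaussianFourier.integral_rexp_neg_mul_sq_norm ha]
    simp
  have hi : Integrable fun z : ℂ => Real.exp (-a * ‖z‖ ^ 2) := by
    by_contra hc
    rw [integral_undef hc] at h1
    exact (div_pos Real.pi_pos ha).ne h1
  have hi' : Integrable fun y : Fin n → ℂ => ∏ t, Real.exp (-a * ‖y t‖ ^ 2) :=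
    Integrable.fintype_prod (f := fun _ z => Real.exp (-a * ‖z‖ ^ 2)) fun _ => hi
  have hi'' : Integrable fun y : ι → Fin n → ℂ => ∏ i, ∏ t, Real.exp (-a * ‖y i t‖ ^ 2) :=
    Integrable.fintype_prod (f := fun _ (y : Fin n → ℂ) => ∏ t, Real.exp (-a * ‖y t‖ ^ 2))
      fun _ => hi'
  have h2 : ∀ y : ι → Fin n → ℂ, Real.exp (-(a * blockEnergy y)) =
      ∏ i, ∏ t, Real.exp (-a * ‖y i t‖ ^ 2) := fun y => by
    simp_rw [← Real.exp_sum, ← Finset.mul_sum, blockEnergy, neg_mul]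
  simp_rw [h2]
  rw [← ofReal_integral_eq_lintegral_ofReal hi'' (ae_of_all _ fun _ => by positivity),
    integral_fintype_prod_volume_eq_pow
      (fun y : Fin n → ℂ => ∏ t, Real.exp (-a * ‖y t‖ ^ 2)),
    integral_fintype_prod_volume_eq_pow (fun z : ℂ => Real.exp (-a * ‖z‖ ^ 2)), h1,
    Fintype.card_fin, pow_mul]

/-- A Gaussian weight in the coordinates in `p`, times a Gaussian weight in the other coordinates
whose centre depends on the coordinates in `p`. -/
lemma lintegral_exp_neg_blockEnergy_shear {ι : Type*} [Fintype ι] (p : ι → Prop)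
    [DecidablePred p] (n : ℕ) {a : ℝ} (ha : 0 < a)
    (m : ({i // p i} → Fin n → ℂ) → ({i // ¬ p i} → Fin n → ℂ)) (hm : Measurable m) :
    ∫⁻ y : ι → Fin n → ℂ, ENNReal.ofReal (Real.exp
      (-(a * blockEnergy (fun i : {i // p i} => y i)
        + blockEnergy ((fun i : {i // ¬ p i} => y i) - m fun i => y i)))) =
      ENNReal.ofReal ((Real.pi / a) ^ (n * Fintype.card {i // p i}) *
        Real.pi ^ (n * Fintype.card {i // ¬ p i})) := by
  have hmp := volume_preserving_piEquivPiSubtypeProd (fun _ : ι => Fin n → ℂ) p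
  have hF : Measurable fun q : ({i // p i} → Fin n → ℂ) × ({i // ¬ p i} → Fin n → ℂ) =>
      ENNReal.ofReal (Real.exp (-(a * blockEnergy q.1 + blockEnergy (q.2 - m q.1)))) := by
    fun_prop
  have h1 := hmp.lintegral_comp hF
  refine h1.trans ?_
  rw [Measure.volume_eq_prod, lintegral_prod _ hF.aemeasurable]
  -- By translation invariance the inner integral does not depend on the centre `m u`.
  have h2 : ∀ u : {i // p i} → Fin n → ℂ, ∫⁻ v : {i // ¬ p i} → Fin n → ℂ,
      ENNReal.ofReal (Real.exp (-(a * blockEnergy u + blockEnergy (v - m u)))) =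
      ENNReal.ofReal (Real.exp (-(a * blockEnergy u))) *
        ENNReal.ofReal (Real.pi ^ (n * Fintype.card {i // ¬ p i})) := fun u => by
    have h3 := lintegral_exp_neg_blockEnergy {i // ¬ p i} n one_pos
    simp only [one_mul, div_one] at h3
    rw [← h3, ← lintegral_sub_right_eq_self
      (fun v => ENNReal.ofReal (Real.exp (-blockEnergy v))) (m u),
      ← lintegral_const_mul _ (by fun_prop)]
    refine lintegral_congr fun v => ?_
    rw [← ENNReal.ofReal_mul (Real.exp_nonneg _), ← Real.exp_add, neg_add]
  simp_rw [h2]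
  rw [lintegral_mul_const _ (by fun_prop), lintegral_exp_neg_blockEnergy _ n ha,
    ← ENNReal.ofReal_mul (by positivity)]

/-- If finitely many translates `S w + s w` are disjoint and `F ≥ 1` on each of them, then the total
measure of the sets `S w` is at most the integral of `F`. -/
lemma sum_measure_le_lintegral_of_disjoint_translates {W Ω : Type*} [AddGroup Ω]
    [MeasurableSpace Ω] [MeasurableAdd₂ Ω] [MeasurableNeg Ω] (μ : Measure Ω)
    [μ.IsAddRightInvariant] (G : Finset W) (s : W → Ω) (S : W → Set Ω)
    (hS : ∀ w, MeasurableSet (S w)) (F : Ω → ℝ≥0∞)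
    (hF : ∀ w ∈ G, ∀ z ∈ S w, 1 ≤ F (z + s w))
    (hdisj : ∀ w ∈ G, ∀ w' ∈ G, ∀ z ∈ S w, ∀ z' ∈ S w', z + s w = z' + s w' → w = w') :
    ∑ w ∈ G, μ (S w) ≤ ∫⁻ y, F y ∂μ := by
  have h1 : ∀ w, μ (S w) = ∫⁻ y, (S w).indicator 1 (y - s w) ∂μ := fun w => by
    rw [lintegral_sub_right_eq_self (fun y => (S w).indicator 1 y), lintegral_indicator_one (hS w)]
  simp_rw [h1]
  rw [← lintegral_finsetSum (f := fun w y => (S w).indicator 1 (y - s w)) _ fun w _ =>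
    ((measurable_one.indicator (hS w)).comp (measurable_id.sub_const (s w)))]
  refine lintegral_mono fun y => ?_
  -- By disjointness at most one indicator is nonzero at `y`, and there `F y ≥ 1`.
  by_cases h : ∃ w ∈ G, y - s w ∈ S w
  · obtain ⟨w, hw, hy⟩ := h
    rw [Finset.sum_eq_single_of_mem w hw]
    · simpa [hy] using hF w hw _ hy
    · intro w' hw' hne
      refine Set.indicator_of_notMem (fun hy' => hne ?_) _
      exact hdisj w' hw' w hw _ hy' _ hy (by simp)
  · push Not at h
    rw [Finset.sum_eq_zero fun w hw => Set.indicator_of_notMem (h w hw) _]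
    exact zero_le

/-! ### Linear algebra of the recovery hypothesis -/

lemma exists_sq_norm_apply_le {ι κ : Type*} [Fintype ι] [Fintype κ]
    (Λ : (ι → ℂ) →ₗ[ℂ] (κ → ℂ)) :
    ∃ c : ℝ, 0 ≤ c ∧ ∀ v k, ‖Λ v k‖ ^ 2 ≤ c * ∑ j, ‖v j‖ ^ 2 := by
  refine ⟨‖LinearMap.toContinuousLinearMap Λ‖ ^ 2, by positivity, fun v k => ?_⟩
  have h1 : ‖Λ v k‖ ≤ ‖LinearMap.toContinuousLinearMap Λ‖ * ‖v‖ :=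
    (norm_le_pi_norm (Λ v) k).trans ((LinearMap.toContinuousLinearMap Λ).le_opNorm v)
  have h2 : ‖v‖ ≤ √(∑ j, ‖v j‖ ^ 2) :=
    (pi_norm_le_iff_of_nonneg (Real.sqrt_nonneg _)).2 fun j => Real.le_sqrt_of_sq_le <|
      Finset.single_le_sum (f := fun j => ‖v j‖ ^ 2) (fun _ _ => by positivity)
        (Finset.mem_univ j)
  calc ‖Λ v k‖ ^ 2 ≤ (‖LinearMap.toContinuousLinearMap Λ‖ * ‖v‖) ^ 2 := by gcongr
    _ = ‖LinearMap.toContinuousLinearMap Λ‖ ^ 2 * ‖v‖ ^ 2 := mul_pow _ _ _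
    _ ≤ _ := by
      gcongr
      calc ‖v‖ ^ 2 ≤ √(∑ j, ‖v j‖ ^ 2) ^ 2 := by gcongr
        _ = _ := Real.sq_sqrt (by positivity)

lemma sq_norm_add_le {E : Type*} [SeminormedAddCommGroup E] (x y : E) :
    ‖x + y‖ ^ 2 ≤ 2 * ‖x‖ ^ 2 + 2 * ‖y‖ ^ 2 := by
  nlinarith [norm_add_le x y, norm_nonneg (x + y), sq_nonneg (‖x‖ - ‖y‖)]

/-- If the inputs in `U` can be recovered from the outputs in `A`, the noises in `A` and the other
inputs, then for inputs supported on `U` all noiseless outputs are a linear function of those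
in `A`. -/
lemma exists_linearMap_extend_output {K : ℕ} (H : Matrix (Fin K) (Fin K) ℂ)
    (A U : Finset (Fin K))
    (hf : ∃ f : ({i : Fin K // i ∈ A} → ℂ) → ({i : Fin K // i ∈ A} → ℂ) →
        ({j : Fin K // j ∈ Uᶜ} → ℂ) → ({j : Fin K // j ∈ U} → ℂ),
      ∀ x z : Fin K → ℂ, f (part A (output H x z)) (part A z) (part Uᶜ x) = part U x) :
    ∃ Ψ : ({i : Fin K // i ∈ A} → ℂ) →ₗ[ℂ] (Fin K → ℂ),
      ∀ x : Fin K → ℂ, (∀ j ∉ U, x j = 0) → Ψ (fun k => (H *ᵥ x) k) = H *ᵥ x := by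
  obtain ⟨f, hf⟩ := hf
  let S : Submodule ℂ (Fin K → ℂ) := ⨅ j ∈ Uᶜ, LinearMap.ker (LinearMap.proj j)
  have hS : ∀ x : Fin K → ℂ, x ∈ S ↔ ∀ j ∉ U, x j = 0 := fun x => by
    simp [S, Submodule.mem_iInf]
  let φ : S →ₗ[ℂ] ({i : Fin K // i ∈ A} → ℂ) :=
    (LinearMap.funLeft ℂ ℂ (Subtype.val : {i : Fin K // i ∈ A} → Fin K)) ∘ₗ
      H.mulVecLin ∘ₗ S.subtype
  have hφ : LinearMap.ker φ = ⊥ := by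
    refine LinearMap.ker_eq_bot'.2 fun x hx => ?_
    have hx' : ∀ k ∈ A, (H *ᵥ (x : Fin K → ℂ)) k = 0 := fun k hk => congrFun hx ⟨k, hk⟩
    have hx0 := (hS x).1 x.2
    -- Without noise, `x` and `0` present the same data to `f`, so they agree on `U`.
    have h1 := hf x 0
    have h2 := hf 0 0
    have h3 : part A (output H x 0) = part A (output H 0 0) := by
      funext k
      have := hx' k k.2
      simpa [part, output, mulVec, dotProduct] using this
    have h4 : part Uᶜ (x : Fin K → ℂ) = part Uᶜ 0 := by
      funext j
      exact hx0 j (Finset.mem_compl.1 j.2)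
    rw [h3, h4, h2] at h1
    ext j
    by_cases hj : j ∈ U
    · exact (congrFun h1 ⟨j, hj⟩).symm
    · exact hx0 j hj
  obtain ⟨L, hL⟩ := φ.exists_leftInverse_of_injective hφ
  refine ⟨H.mulVecLin ∘ₗ S.subtype ∘ₗ L, fun x hx => ?_⟩
  have := LinearMap.congr_fun hL ⟨x, (hS x).2 hx⟩
  change H *ᵥ (L (φ ⟨x, (hS x).2 hx⟩) : Fin K → ℂ) = _
  rw [← LinearMap.comp_apply, this]
  rfl

/-! ### Estimating the other outputs from those in `A` -/

namespace Code

variable {K n : ℕ} {T : Fin K → Finset (Fin K)}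

/-- The messages decoded by the receivers in `A`, completed by default values. -/
def decodedMessages (c : Code T n) (A : Finset (Fin K)) (u : {i // i ∈ A} → Fin n → ℂ) :
    c.Messages :=
  fun i => if h : i ∈ A then c.dec i (u ⟨i, h⟩) else ⟨0, c.size_pos i⟩

/-- The signals of the transmitters that know messages in `A` only. -/
noncomputable def insideSignal (c : Code T n) (A : Finset (Fin K)) (w : c.Messages) (t : Fin n) :
    Fin K → ℂ :=
  fun j => if j ∈ outsideTransmitters T A then 0 else c.signal w j t

/-- A transmitter outside `outsideTransmitters T A` knows no message outside `A`. Thus the default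
values in `decodedMessages` do no harm. -/
lemma insideSignal_congr (c : Code T n) {A : Finset (Fin K)} {w w' : c.Messages}
    (h : ∀ i ∈ A, w i = w' i) : c.insideSignal A w = c.insideSignal A w' := by
  funext t j
  unfold insideSignal signal
  split_ifs with hj
  · rfl
  · have hw : (fun i : {i : Fin K // j ∈ T i} => w i) = fun i : {i : Fin K // j ∈ T i} => w' i := by
      refine funext fun i => h i ?_
      by_contra hi
      exact hj (Finset.mem_biUnion.2 ⟨i, Finset.mem_compl.2 hi, i.2⟩)
    rw [hw]

/-- The estimate of the other outputs from the outputs in `A`. -/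
noncomputable def estimate (c : Code T n) (H : Matrix (Fin K) (Fin K) ℂ) (A : Finset (Fin K))
    (Ψ : ({i : Fin K // i ∈ A} → ℂ) →ₗ[ℂ] (Fin K → ℂ)) (u : {i // i ∈ A} → Fin n → ℂ) :
    {i // ¬ i ∈ A} → Fin n → ℂ :=
  fun i t => (H *ᵥ c.insideSignal A (c.decodedMessages A u) t) i +
    Ψ (fun k => u k t - (H *ᵥ c.insideSignal A (c.decodedMessages A u) t) k) i

lemma measurable_estimate (c : Code T n) (H : Matrix (Fin K) (Fin K) ℂ) (A : Finset (Fin K))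
    (Ψ : ({i : Fin K // i ∈ A} → ℂ) →ₗ[ℂ] (Fin K → ℂ)) : Measurable (c.estimate H A Ψ) := by
  have hd : Measurable (c.decodedMessages A) := by
    refine measurable_pi_lambda _ fun i => ?_
    unfold decodedMessages
    by_cases h : i ∈ A
    · simp only [h, dite_true]
      exact (c.measurable_dec i).comp (measurable_pi_apply (⟨i, h⟩ : {i // i ∈ A}))
    · simp [h]
  have hx : ∀ (k : Fin K) (t : Fin n), Measurable fun u : {i // i ∈ A} → Fin n → ℂ =>
      (H *ᵥ c.insideSignal A (c.decodedMessages A u) t) k := fun k t =>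
    (Measurable.of_discrete (f := fun w : c.Messages => (H *ᵥ c.insideSignal A w t) k)).comp hd
  have hΨ : Measurable Ψ := (LinearMap.continuous_of_finiteDimensional Ψ).measurable
  refine measurable_pi_lambda _ fun i => measurable_pi_lambda _ fun t => ?_
  refine (hx i t).add ((measurable_pi_apply (i : Fin K)).comp (hΨ.comp ?_))
  exact measurable_pi_lambda _ fun k => Measurable.sub (by fun_prop) (hx k t)

lemma received_eq (c : Code T n) (H : Matrix (Fin K) (Fin K) ℂ) (w : c.Messages)
    (z : Fin K → Fin n → ℂ) (i : Fin K) (t : Fin n) :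
    c.received H w z i t = (H *ᵥ fun j => c.signal w j t) i + z i t := rfl

/-- After correct decoding the remaining input is supported on `outsideTransmitters T A`, where `Ψ`
is exact. The codeword cancels and only noise is left, independently of the power. -/
lemma received_sub_estimate (c : Code T n) (H : Matrix (Fin K) (Fin K) ℂ) (A : Finset (Fin K))
    (Ψ : ({i : Fin K // i ∈ A} → ℂ) →ₗ[ℂ] (Fin K → ℂ))
    (hΨ : ∀ x : Fin K → ℂ, (∀ j ∉ outsideTransmitters T A, x j = 0) →
      Ψ (fun k => (H *ᵥ x) k) = H *ᵥ x)
    (w : c.Messages) (z : Fin K → Fin n → ℂ)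
    (hw : ∀ i ∈ A, c.dec i (c.received H w z i) = w i) (i : {i // ¬ i ∈ A}) (t : Fin n) :
    c.received H w z i t - c.estimate H A Ψ (fun k => c.received H w z k) i t =
      z i t - Ψ (fun k => z k t) i := by
  have h1 : c.insideSignal A (c.decodedMessages A fun k => c.received H w z k) =
      c.insideSignal A w :=
    c.insideSignal_congr fun k hk => by simp [decodedMessages, hk, hw k hk]
  set x : Fin K → ℂ := fun j => c.signal w j t
  set xi := c.insideSignal A w t with hxi
  have h2 := hΨ (x - xi) fun j hj => by simp [hxi, insideSignal, hj, x]
  have h3 : (fun k : {i // i ∈ A} => c.received H w z k t - (H *ᵥ xi) k) =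
      (fun k : {i // i ∈ A} => (H *ᵥ (x - xi)) k) + fun k : {i // i ∈ A} => z k t := by
    funext k
    rw [received_eq, Pi.add_apply, mulVec_sub, Pi.sub_apply]
    ring
  unfold estimate
  rw [h1, h3, map_add, h2, received_eq, Pi.add_apply, mulVec_sub, Pi.sub_apply]
  ring

lemma blockEnergy_received_le (c : Code T n) (H : Matrix (Fin K) (Fin K) ℂ) (A : Finset (Fin K))
    {b : ℝ} (hb : ∀ v k, ‖(H *ᵥ v) k‖ ^ 2 ≤ b * ∑ j, ‖v j‖ ^ 2) (w : c.Messages)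
    (z : Fin K → Fin n → ℂ) :
    blockEnergy (fun i : {i // i ∈ A} => c.received H w z i) ≤
      2 * K * b * blockEnergy (c.signal w) + 2 * blockEnergy z := by
  calc blockEnergy (fun i : {i // i ∈ A} => c.received H w z i)
      = ∑ i ∈ A, ∑ t, ‖c.received H w z i t‖ ^ 2 :=
        Finset.sum_coe_sort A fun i => ∑ t, ‖c.received H w z i t‖ ^ 2
    _ ≤ ∑ i, ∑ t, ‖c.received H w z i t‖ ^ 2 :=
        Finset.sum_le_sum_of_subset_of_nonneg (Finset.subset_univ A) fun _ _ _ => by positivity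
    _ ≤ ∑ i, ∑ t, (2 * (b * ∑ j, ‖c.signal w j t‖ ^ 2) + 2 * ‖z i t‖ ^ 2) := by
        refine Finset.sum_le_sum fun i _ => Finset.sum_le_sum fun t _ => ?_
        rw [received_eq]
        exact (sq_norm_add_le _ _).trans (by gcongr; exact hb _ _)
    _ = _ := by
        simp only [blockEnergy, Finset.sum_add_distrib, ← Finset.mul_sum]
        rw [Finset.sum_comm (f := fun t j => ‖c.signal w j t‖ ^ 2)]
        simp
        ring

/-- For correctly decoded messages, the squared error in estimating the other outputs from those
in `A` is at most a multiple of the noise energy. -/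
lemma blockEnergy_received_sub_estimate_le (c : Code T n) (H : Matrix (Fin K) (Fin K) ℂ)
    (A : Finset (Fin K)) (Ψ : ({i : Fin K // i ∈ A} → ℂ) →ₗ[ℂ] (Fin K → ℂ))
    (hΨ : ∀ x : Fin K → ℂ, (∀ j ∉ outsideTransmitters T A, x j = 0) →
      Ψ (fun k => (H *ᵥ x) k) = H *ᵥ x)
    {b : ℝ} (hb0 : 0 ≤ b) (hb : ∀ v k, ‖Ψ v k‖ ^ 2 ≤ b * ∑ j, ‖v j‖ ^ 2)
    (w : c.Messages) (z : Fin K → Fin n → ℂ)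
    (hw : ∀ i ∈ A, c.dec i (c.received H w z i) = w i) :
    blockEnergy ((fun i : {i // ¬ i ∈ A} => c.received H w z i) -
      c.estimate H A Ψ fun i => c.received H w z i) ≤ (2 + 2 * K * b) * blockEnergy z := by
  calc _ = ∑ i : {i // ¬ i ∈ A}, ∑ t, ‖z i t - Ψ (fun k => z k t) i‖ ^ 2 := by
        refine Finset.sum_congr rfl fun i _ => Finset.sum_congr rfl fun t _ => ?_
        rw [← received_sub_estimate c H A Ψ hΨ w z hw]
        rfl
    _ ≤ ∑ i : {i // ¬ i ∈ A}, ∑ t, (2 * ‖z i t‖ ^ 2 + 2 * (b * ∑ j, ‖z j t‖ ^ 2)) := by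
        refine Finset.sum_le_sum fun i _ => Finset.sum_le_sum fun t _ => ?_
        rw [sub_eq_add_neg]
        refine (sq_norm_add_le _ _).trans ?_
        rw [norm_neg]
        gcongr
        refine (hb _ _).trans ?_
        gcongr
        rw [Finset.sum_coe_sort A fun j => ‖z j t‖ ^ 2]
        exact Finset.sum_le_sum_of_subset_of_nonneg (Finset.subset_univ A)
          fun _ _ _ => by positivity
    _ ≤ ∑ i, ∑ t, (2 * ‖z i t‖ ^ 2 + 2 * (b * ∑ j, ‖z j t‖ ^ 2)) := by
        rw [← Finset.sum_subtype (Finset.univ.filter fun i => ¬ i ∈ A) (by simp)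
          fun i => ∑ t, (2 * ‖z i t‖ ^ 2 + 2 * (b * ∑ j, ‖z j t‖ ^ 2))]
        exact Finset.sum_le_sum_of_subset_of_nonneg (Finset.subset_univ _)
          fun _ _ _ => by positivity
    _ = _ := by
        simp only [blockEnergy, Finset.sum_add_distrib, ← Finset.mul_sum]
        rw [Finset.sum_comm (f := fun t j => ‖z j t‖ ^ 2)]
        simp
        ring

/-! ### Packing bound and number of messages -/

/-- The noise blocks of energy less than `E` for which all receivers decode correctly. -/
def goodNoise (c : Code T n) (H : Matrix (Fin K) (Fin K) ℂ) (E : ℝ) (w : c.Messages) :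
    Set (Fin K → Fin n → ℂ) :=
  {z | (∀ i, c.dec i (c.received H w z i) = w i) ∧ blockEnergy z < E}

lemma received_eq_add (c : Code T n) (H : Matrix (Fin K) (Fin K) ℂ) (w : c.Messages)
    (z : Fin K → Fin n → ℂ) :
    c.received H w z = z + fun i t => (H *ᵥ fun j => c.signal w j t) i := by
  funext i t
  rw [received_eq, add_comm]
  rfl

lemma measurableSet_decode_eq (c : Code T n) (H : Matrix (Fin K) (Fin K) ℂ) (w : c.Messages)
    (i : Fin K) : MeasurableSet {z | c.dec i (c.received H w z i) = w i} := by
  have h : Measurable fun z => c.dec i (c.received H w z i) := by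
    refine (c.measurable_dec i).comp ?_
    simp_rw [received_eq_add]
    fun_prop
  exact h (measurableSet_singleton (w i))

lemma measurableSet_goodNoise (c : Code T n) (H : Matrix (Fin K) (Fin K) ℂ) (E : ℝ)
    (w : c.Messages) : MeasurableSet (c.goodNoise H E w) := by
  have h : c.goodNoise H E w =
      (⋂ i, {z | c.dec i (c.received H w z i) = w i}) ∩ {z | blockEnergy z < E} := by
    ext z
    simp [goodNoise]
  rw [h]
  exact (MeasurableSet.iInter fun i => c.measurableSet_decode_eq H w i).inter
    (measurableSet_lt measurable_blockEnergy measurable_const)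

/-- The volume bound: among messages whose codewords have energy at most `4 n P`, the success
probabilities add up to at most `exp (O(n)) * P ^ (n |A|)`. -/
lemma sum_noise_goodNoise_le (c : Code T n) (H : Matrix (Fin K) (Fin K) ℂ)
    (A : Finset (Fin K)) (Ψ : ({i : Fin K // i ∈ A} → ℂ) →ₗ[ℂ] (Fin K → ℂ))
    (hΨ : ∀ x : Fin K → ℂ, (∀ j ∉ outsideTransmitters T A, x j = 0) →
      Ψ (fun k => (H *ᵥ x) k) = H *ᵥ x)
    {b b' C P : ℝ} (hb0 : 0 ≤ b) (hb : ∀ v k, ‖(H *ᵥ v) k‖ ^ 2 ≤ b * ∑ j, ‖v j‖ ^ 2)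
    (hb0' : 0 ≤ b') (hb' : ∀ v k, ‖Ψ v k‖ ^ 2 ≤ b' * ∑ j, ‖v j‖ ^ 2)
    (hP : 1 ≤ P) (hC : 0 ≤ C) (G : Finset c.Messages)
    (hG : ∀ w ∈ G, blockEnergy (c.signal w) ≤ 4 * (n * P)) :
    ∑ w ∈ G, (noise K n).real (c.goodNoise H (C * n) w) ≤
      Real.exp ((8 * K * b + 2 * C + (2 + 2 * K * b') * C) * n) *
        (Real.pi ^ (n * K) * P ^ (n * A.card)) := by
  have hP0 : 0 < P := one_pos.trans_le hP
  -- `D` bounds the exponent on good outputs: `8 * K * b + 2 * C` comes from the energy in `A`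
  -- divided by `P ≥ 1`, the rest from the estimation error.
  set D := (8 * K * b + 2 * C + (2 + 2 * K * b') * C) * n with hD
  let F : (Fin K → Fin n → ℂ) → ℝ := fun y => Real.exp
      (-(P⁻¹ * blockEnergy (fun i : {i // i ∈ A} => y i)
        + blockEnergy ((fun i : {i // ¬ i ∈ A} => y i) - c.estimate H A Ψ fun i => y i)))
  have key := sum_measure_le_lintegral_of_disjoint_translates
    (volume : Measure (Fin K → Fin n → ℂ)) G
    (fun w i t => (H *ᵥ fun j => c.signal w j t) i) (c.goodNoise H (C * n))
    (c.measurableSet_goodNoise H _)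
    (fun y => ENNReal.ofReal (Real.exp D) * ENNReal.ofReal (F y))
    (fun w hw z hz => ?_) fun w _ w' _ z hz z' hz' h => ?_
  · have hint : ∫⁻ y, ENNReal.ofReal (F y) =
        ENNReal.ofReal ((Real.pi / P⁻¹) ^ (n * Fintype.card {i // i ∈ A}) *
          Real.pi ^ (n * Fintype.card {i // ¬ i ∈ A})) := by
      convert! lintegral_exp_neg_blockEnergy_shear (fun i => i ∈ A) n (inv_pos.2 hP0) _
        (c.measurable_estimate H A Ψ)
    rw [lintegral_const_mul' _ _ ENNReal.ofReal_ne_top, hint,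
      ← ENNReal.ofReal_mul (Real.exp_nonneg _)] at key
    have hle := (Finset.sum_le_sum fun w (_ : w ∈ G) =>
      noise_le_volume K n (c.goodNoise H (C * n) w)).trans key
    have hreal : ∀ w, noise K n (c.goodNoise H (C * n) w) =
        ENNReal.ofReal ((noise K n).real (c.goodNoise H (C * n) w)) := fun w =>
      (ofReal_measureReal (measure_ne_top _ _)).symm
    simp_rw [hreal] at hle
    rw [← ENNReal.ofReal_sum_of_nonneg fun _ _ => measureReal_nonneg,
      ENNReal.ofReal_le_ofReal_iff (by positivity)] at hle
    refine hle.trans_eq ?_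
    congr 1
    have hcard : A.card ≤ K := by simpa using A.card_le_univ
    have hsplit : n * K = n * A.card + n * (K - A.card) := by
      rw [← mul_add, Nat.add_sub_cancel' hcard]
    rw [Fintype.card_subtype_compl, Fintype.card_coe, Fintype.card_fin, div_inv_eq_mul, mul_pow,
      hsplit, pow_add]
    ring
  · rw [← received_eq_add, ← ENNReal.ofReal_mul (Real.exp_nonneg _), ← Real.exp_add,
      ENNReal.one_le_ofReal, Real.one_le_exp_iff]
    have h1 := c.blockEnergy_received_le H A hb w z
    have h2 := c.blockEnergy_received_sub_estimate_le H A Ψ hΨ hb0' hb' w z fun i _ => hz.1 i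
    have h3 := hz.2.le
    have h4 := hG w hw
    have h5 : P⁻¹ * blockEnergy (fun i : {i // i ∈ A} => c.received H w z i) ≤
        (8 * K * b + 2 * C) * n := by
      rw [inv_mul_le_iff₀ hP0]
      calc _ ≤ 2 * K * b * (4 * (n * P)) + 2 * (C * n) := h1.trans (by gcongr)
        _ ≤ 2 * K * b * (4 * (n * P)) + 2 * (P * (C * n)) := by
          gcongr 2 * K * b * (4 * (n * P)) + 2 * ?_
          exact le_mul_of_one_le_left (by positivity) hP
        _ = _ := by ring
    have h6 := h2.trans (mul_le_mul_of_nonneg_left h3 (by positivity))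
    rw [hD]
    linarith
  -- Equal outputs are decoded alike by every receiver, so all messages coincide.
  · rw [← received_eq_add, ← received_eq_add] at h
    funext i
    rw [← hz.1 i, ← hz'.1 i, h]

lemma noise_goodNoise_ge (c : Code T n) (H : Matrix (Fin K) (Fin K) ℂ) (E : ℝ)
    (w : c.Messages) :
    1 - ∑ i, (noise K n).real {z | c.dec i (c.received H w z i) ≠ w i} -
      (noise K n).real {z | E ≤ blockEnergy z} ≤ (noise K n).real (c.goodNoise H E w) := by
  have h1 := probReal_compl_eq_one_sub (μ := noise K n) (c.measurableSet_goodNoise H E w)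
  have h2 : (c.goodNoise H E w)ᶜ ⊆
      (⋃ i, {z | c.dec i (c.received H w z i) ≠ w i}) ∪ {z | E ≤ blockEnergy z} := by
    intro z hz
    by_contra h
    simp only [Set.mem_union, Set.mem_iUnion, Set.mem_ofPred_eq, not_or, not_exists, not_not,
      not_le] at h
    exact hz h
  have h3 := (measureReal_mono (μ := noise K n) h2).trans (measureReal_union_le _ _)
  have h4 := measureReal_iUnion_fintype_le (μ := noise K n)
    fun i => {z | c.dec i (c.received H w z i) ≠ w i}
  linarith

lemma card_messages_pos (c : Code T n) : 0 < Fintype.card c.Messages :=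
  Fintype.card_pos_iff.2 ⟨fun i => ⟨0, c.size_pos i⟩⟩

/-- At least three quarters of the messages have energy at most four times the average. -/
lemma card_low_energy_ge (c : Code T n) {E : ℝ} (hE : 0 < E) (hc : c.energy ≤ E) :
    3 / 4 * (Fintype.card c.Messages : ℝ) ≤
      (Finset.univ.filter fun w : c.Messages => blockEnergy (c.signal w) ≤ 4 * E).card := by
  have hM : (0 : ℝ) < Fintype.card c.Messages := by exact_mod_cast c.card_messages_pos
  have h1 : ∑ w : c.Messages, blockEnergy (c.signal w) ≤ E * Fintype.card c.Messages :=
    (div_le_iff₀ hM).1 hc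
  have h2 := Finset.card_filter_add_card_filter_not (s := (Finset.univ : Finset c.Messages))
    fun w => blockEnergy (c.signal w) ≤ 4 * E
  have h3 : (Finset.univ.filter fun w : c.Messages =>
      ¬ blockEnergy (c.signal w) ≤ 4 * E).card * (4 * E) ≤
      ∑ w : c.Messages, blockEnergy (c.signal w) := by
    rw [← nsmul_eq_mul]
    refine (Finset.card_nsmul_le_sum _ (fun w => blockEnergy (c.signal w)) _ fun w hw => ?_).trans
      (Finset.sum_le_sum_of_subset_of_nonneg (Finset.subset_univ _)
        fun w _ _ => blockEnergy_nonneg _)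
    exact (not_le.1 (Finset.mem_filter.1 hw).2).le
  have h4 : ((Finset.univ.filter fun w : c.Messages =>
      ¬ blockEnergy (c.signal w) ≤ 4 * E).card : ℝ) * 4 ≤ Fintype.card c.Messages := by
    refine le_of_mul_le_mul_left ?_ hE
    linarith
  have h5 : ((Finset.univ.filter fun w : c.Messages =>
      blockEnergy (c.signal w) ≤ 4 * E).card : ℝ) + (Finset.univ.filter fun w : c.Messages =>
      ¬ blockEnergy (c.signal w) ≤ 4 * E).card = Fintype.card c.Messages := by
    exact_mod_cast h2
  linarith

/-- The number of messages of a reliable code of power `P` is at most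
`4 exp (O(n)) * P ^ (n |A|)`. -/
lemma card_messages_le (c : Code T n) (hn : 0 < n) (H : Matrix (Fin K) (Fin K) ℂ)
    (A : Finset (Fin K)) (Ψ : ({i : Fin K // i ∈ A} → ℂ) →ₗ[ℂ] (Fin K → ℂ))
    (hΨ : ∀ x : Fin K → ℂ, (∀ j ∉ outsideTransmitters T A, x j = 0) →
      Ψ (fun k => (H *ᵥ x) k) = H *ᵥ x)
    {b b' C P : ℝ} (hb0 : 0 ≤ b) (hb : ∀ v k, ‖(H *ᵥ v) k‖ ^ 2 ≤ b * ∑ j, ‖v j‖ ^ 2)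
    (hb0' : 0 ≤ b') (hb' : ∀ v k, ‖Ψ v k‖ ^ 2 ≤ b' * ∑ j, ‖v j‖ ^ 2)
    (hP : 1 ≤ P) (hC : 0 ≤ C) (hCn : (noise K n).real {z | C * n ≤ blockEnergy z} ≤ 1 / 4)
    (hc : c.energy ≤ n * P) (hε : ∀ i, c.errorProb H i ≤ 1 / (4 * (K + 1))) :
    (Fintype.card c.Messages : ℝ) ≤
      4 * (Real.exp ((8 * K * b + 2 * C + (2 + 2 * K * b') * C) * n) *
        (Real.pi ^ (n * K) * P ^ (n * A.card))) := by
  have hM : (0 : ℝ) < Fintype.card c.Messages := by exact_mod_cast c.card_messages_pos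
  have hn' : (0 : ℝ) < n := by exact_mod_cast hn
  set G := Finset.univ.filter fun w : c.Messages => blockEnergy (c.signal w) ≤ 4 * (n * P)
  have hG := c.card_low_energy_ge (by positivity) hc
  have hup := c.sum_noise_goodNoise_le H A Ψ hΨ hb0 hb hb0' hb' hP hC G
    fun w hw => (Finset.mem_filter.1 hw).2
  let e : c.Messages → ℝ := fun w =>
    ∑ i, (noise K n).real {z | c.dec i (c.received H w z i) ≠ w i}
  -- The tolerance `1 / (4 * (K + 1))`, summed over `K` receivers, stays below `1/4`.
  have he : ∑ w ∈ G, e w ≤ 1 / 4 * Fintype.card c.Messages := by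
    calc ∑ w ∈ G, e w ≤ ∑ w, e w :=
          Finset.sum_le_sum_of_subset_of_nonneg (Finset.subset_univ _) fun w _ _ =>
            Finset.sum_nonneg fun _ _ => measureReal_nonneg
      _ = ∑ i, c.errorProb H i * Fintype.card c.Messages := by
          simp only [e, errorProb, div_mul_cancel₀ _ hM.ne']
          exact Finset.sum_comm
      _ ≤ ∑ _i : Fin K, 1 / (4 * ((K : ℝ) + 1)) * Fintype.card c.Messages :=
          Finset.sum_le_sum fun i _ => mul_le_mul_of_nonneg_right (hε i) hM.le
      _ = K * (1 / (4 * ((K : ℝ) + 1))) * Fintype.card c.Messages := by simp [mul_assoc]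
      _ ≤ _ := by
          refine mul_le_mul_of_nonneg_right ?_ hM.le
          rw [mul_one_div, div_le_div_iff₀ (by positivity) (by norm_num)]
          linarith
  have hlow : ∑ w ∈ G, (3 / 4 - e w) ≤
      ∑ w ∈ G, (noise K n).real (c.goodNoise H (C * n) w) :=
    Finset.sum_le_sum fun w _ => by
      have := c.noise_goodNoise_ge H (C * n) w
      simp only [e]
      linarith
  rw [Finset.sum_sub_distrib, Finset.sum_const, nsmul_eq_mul] at hlow
  -- At least `3/4 * 3/4 - 1/4 = 5/16` of the number of messages remains on the left, which exceeds
  -- the required quarter.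
  linarith

end Code

/-! ### From message counts to degrees of freedom -/

/-- The sum rate is at most `|A| log P` up to a constant. -/
lemma exists_sumRate_le {K : ℕ} (H : Matrix (Fin K) (Fin K) ℂ) (T : Fin K → Finset (Fin K))
    (A : Finset (Fin K)) (Ψ : ({i : Fin K // i ∈ A} → ℂ) →ₗ[ℂ] (Fin K → ℂ))
    (hΨ : ∀ x : Fin K → ℂ, (∀ j ∉ outsideTransmitters T A, x j = 0) →
      Ψ (fun k => (H *ᵥ x) k) = H *ᵥ x) :
    ∃ B : ℝ, ∀ P : ℝ, 1 ≤ P → ∀ R ∈ capacityRegion H T P,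
      ∑ i, R i ≤ A.card * Real.log P + B := by
  obtain ⟨b, hb0, hb⟩ := exists_sq_norm_apply_le H.mulVecLin
  obtain ⟨b', hb0', hb'⟩ := exists_sq_norm_apply_le Ψ
  obtain ⟨C, hC, hCn⟩ := exists_noise_energy_tail_le K
  refine ⟨Real.log 4 + (8 * K * b + 2 * C + (2 + 2 * K * b') * C) + K * Real.log Real.pi,
    fun P hP R hR => ?_⟩
  -- One positive block length and one fixed error tolerance suffice, since the bound is uniform in
  -- `n`.
  obtain ⟨n, ⟨c, hc, hrate, herr⟩, hn⟩ :=
    ((hR.2 (1 / (4 * (K + 1))) (by positivity)).and (eventually_ge_atTop 1)).exists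
  have hn' : (1 : ℝ) ≤ n := by exact_mod_cast hn
  have hn0 : (0 : ℝ) < n := one_pos.trans_le hn'
  have hP0 : 0 < P := one_pos.trans_le hP
  have hM : (0 : ℝ) < Fintype.card c.Messages := by exact_mod_cast c.card_messages_pos
  have h1 := Real.log_le_log hM <|
    c.card_messages_le hn H A Ψ hΨ hb0 hb hb0' hb' hP hC.le (hCn n hn) hc herr
  rw [Real.log_mul (by norm_num) (by positivity), Real.log_mul (by positivity) (by positivity),
    Real.log_mul (by positivity) (by positivity), Real.log_exp, Real.log_pow, Real.log_pow] at h1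
  have h2 : Real.log (Fintype.card c.Messages) = ∑ i, Real.log (c.size i) := by
    simp only [Code.Messages, Fintype.card_pi, Fintype.card_fin, Nat.cast_prod]
    exact Real.log_prod fun i _ => by exact_mod_cast (c.size_pos i).ne'
  have h3 : ∑ i, R i ≤ Real.log (Fintype.card c.Messages) / n := by
    rw [h2, Finset.sum_div]
    exact Finset.sum_le_sum fun i _ => hrate i
  refine h3.trans ((div_le_iff₀ hn0).2 (h1.trans ?_))
  have h4 : Real.log 4 ≤ Real.log 4 * n :=
    le_mul_of_one_le_right (Real.log_nonneg (by norm_num)) hn'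
  push_cast
  nlinarith

/-- The constant `B` vanishes after division by `log P`. The bound passes to the supremum in
`EReal`, so finiteness of the capacity is not needed beforehand. -/
lemma dof_le_of_sumRate_le {K : ℕ} {H : Matrix (Fin K) (Fin K) ℂ} {T : Fin K → Finset (Fin K)}
    {d B : ℝ} (h : ∀ P : ℝ, 1 ≤ P → ∀ R ∈ capacityRegion H T P, ∑ i, R i ≤ d * Real.log P + B) :
    dof H T ≤ (d : EReal) := by
  have hlim : Tendsto (fun P : ℝ => d + B / Real.log P) atTop (nhds (d + 0)) :=
    (Real.tendsto_log_atTop.const_div_atTop B).const_add d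
  rw [add_zero] at hlim
  have hlim' : Tendsto (fun P : ℝ => ((d + B / Real.log P : ℝ) : EReal)) atTop (nhds (d : EReal)) :=
    (continuous_coe_real_ereal.tendsto d).comp hlim
  rw [← hlim'.limsup_eq]
  refine limsup_le_limsup ?_
  filter_upwards [eventually_gt_atTop 1] with P hP
  have hlog : 0 < Real.log P := Real.log_pos hP
  have h1 : sumCapacity H T P ≤ ((d * Real.log P + B : ℝ) : EReal) :=
    iSup₂_le fun R hR => EReal.coe_le_coe_iff.2 (h P hP.le R hR)
  refine (EReal.div_le_div_right_of_nonneg (EReal.coe_nonneg.2 hlog.le) h1).trans_eq ?_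
  rw [← EReal.coe_div, add_div, mul_div_cancel_right₀ _ hlog.ne']

end InterferenceChannel

theorem lemma2 {K : ℕ} (H : Matrix (Fin K) (Fin K) ℂ) (T : Fin K → Finset (Fin K))
    (A : Finset (Fin K))
    (hf : ∃ f : ({i : Fin K // i ∈ A} → ℂ) → ({i : Fin K // i ∈ A} → ℂ) →
        ({j : Fin K // j ∈ (outsideTransmitters T A)ᶜ} → ℂ) →
        ({j : Fin K // j ∈ outsideTransmitters T A} → ℂ),
      ∀ x z : Fin K → ℂ,
        f (part A (output H x z)) (part A z) (part (outsideTransmitters T A)ᶜ x) =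
          part (outsideTransmitters T A) x) :
    dof H T ≤ ((A.card : ℕ) : EReal) := by
  obtain ⟨Ψ, hΨ⟩ := exists_linearMap_extend_output H A (outsideTransmitters T A) hf
  obtain ⟨B, hB⟩ := exists_sumRate_le H T A Ψ hΨ
  exact dof_le_of_sumRate_le hB
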